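/- Theorem (continuous Krishna–Parthasarathy entropic uncertainty principle). Let $(\Omega,\mu)$ and $(\Delta,\nu)$ be finite measure spaces, and let $\mathcal H,\mathcal H_0$ be Hilbert spaces, not necessarily finite dimensional, over $\mathbb K=\mathbb R$ or $\mathbb C$. A family $\{A_\alpha\}_{\alpha\in\Omega}$ of bounded linear operators $\mathcal H\to\mathcal H_0$ is called a continuous operator-valued Parseval frame if for every $h\in\mathcal H$ the map $\alpha\mapsto A_\alpha h$ is weakly measurable (that is, $\alpha\mapsto\langle A_\alpha h,y\rangle$ is measurable for every $y\in\mathcal H_0$) and $$\|h\|^2=\int_\Omega\|A_\alpha h\|^2\,d\mu(\alpha)\qquad\text{for all } h\in\mathcal H.$$ For such a family put $\mathcal H_A=\{h\in\mathcal H:\|h\|=1,\ A_\alpha h\neq 0\ \text{for all }\alpha\in\Omega\}$ and, for $h\in\mathcal H_A$, $$S_A(h)=-\int_\Omega\|A_\alpha h\|^2\log\|A_\alpha h\|^2\,d\mu(\alpha)\in[-\infty,\infty).$$ (The integral exists in $(-\infty,+\infty]$, because $t\log t\ge -1/e$ for $t>0$ and $\mu(\Omega)<\infty$.) Let $\{A_\alpha\}_{\alpha\in\Omega}$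 and $\{B_\beta\}_{\beta\in\Delta}$ be continuous operator-valued Parseval frames of operators $\mathcal H\to\mathcal H_0$, with respect to $\mu$ and $\nu$ respectively. Then for every $h\in\mathcal H_A\cap\mathcal H_B$, $$\log\bigl(\mu(\Omega)\,\nu(\Delta)\bigr)\ \ge\ S_A(h)+S_B(h)\ \ge\ -2\log\Bigl(\sup_{\alpha\in\Omega,\ \beta\in\Delta}\|B_\beta A_\alpha^*\|\Bigr),$$ where the supremum is taken in $[0,\infty]$, $\log 0=-\infty$ and $\log\infty=+\infty$. -/

import Mathlib

open MeasureTheory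

/-- A family `A α`, `α ∈ Ω`, of bounded operators `H → H₀` is a continuous operator-valued Parseval
frame: every `α ↦ A α h` is weakly measurable, and `‖h‖² = ∫ ‖A α h‖² dμ(α)` for every `h`. -/
structure IsOperatorValuedParsevalFrame {𝕜 Ω H H₀ : Type*} [RCLike 𝕜] [MeasurableSpace Ω]
    [NormedAddCommGroup H] [InnerProductSpace 𝕜 H]
    [NormedAddCommGroup H₀] [InnerProductSpace 𝕜 H₀]
    (μ : Measure Ω) (A : Ω → H →L[𝕜] H₀) : Prop where
  weaklyMeasurable : ∀ (h : H) (y : H₀), Measurable fun α => inner 𝕜 y (A α h)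
  norm_sq_eq : ∀ h : H, ‖h‖ ^ 2 = ∫ α, ‖A α h‖ ^ 2 ∂μ

/-- The Parseval identity is never an equation about a meaningless integral: it forces
`α ↦ ‖A α h‖²` to be integrable (in particular measurable up to a null set). -/
theorem IsOperatorValuedParsevalFrame.integrable_norm_sq {𝕜 Ω H H₀ : Type*} [RCLike 𝕜]
    [MeasurableSpace Ω] [NormedAddCommGroup H] [InnerProductSpace 𝕜 H]
    [NormedAddCommGroup H₀] [InnerProductSpace 𝕜 H₀]
    {μ : Measure Ω} {A : Ω → H →L[𝕜] H₀} (hA : IsOperatorValuedParsevalFrame μ A) (h : H) :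
    Integrable (fun α => ‖A α h‖ ^ 2) μ := by
  by_cases h0 : h = 0
  · simp [h0]
  · by_contra hn
    have := hA.norm_sq_eq h
    rw [integral_undef hn] at this
    exact h0 (by simpa using this)

/-- The integral of a real function as an extended real, `∫ f⁺ - ∫ f⁻`. It has its usual meaning as
soon as one of the two parts has a finite integral. -/
noncomputable def extendedIntegral {Ω : Type*} [MeasurableSpace Ω] (μ : Measure Ω) (f : Ω → ℝ) :
    EReal :=
  ((∫⁻ α, ENNReal.ofReal (f α) ∂μ : ENNReal) : EReal) -
    ((∫⁻ α, ENNReal.ofReal (-f α) ∂μ : ENNReal) : EReal)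

/-- For integrable functions the extended integral is the Bochner integral. -/
theorem extendedIntegral_eq_integral {Ω : Type*} [MeasurableSpace Ω] {μ : Measure Ω} {f : Ω → ℝ}
    (hf : Integrable f μ) : extendedIntegral μ f = ((∫ α, f α ∂μ : ℝ) : EReal) := by
  rw [extendedIntegral, integral_eq_lintegral_pos_part_sub_lintegral_neg_part hf, EReal.coe_sub,
    EReal.coe_ennreal_toReal hf.lintegral_lt_top.ne,
    EReal.coe_ennreal_toReal (by simpa using hf.neg.lintegral_lt_top.ne)]

/-- The continuous Shannon entropy `S_A(h) = -∫ ‖A α h‖² log ‖A α h‖² dμ(α)`. The integrand is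
bounded below by `-1/e`, so over a finite measure space the integral exists in `(-∞, +∞]`, and
`S_A(h)` is a real number or `-∞`. -/
noncomputable def continuousShannonEntropy {𝕜 Ω H H₀ : Type*} [RCLike 𝕜] [MeasurableSpace Ω]
    [NormedAddCommGroup H] [InnerProductSpace 𝕜 H]
    [NormedAddCommGroup H₀] [InnerProductSpace 𝕜 H₀]
    (μ : Measure Ω) (A : Ω → H →L[𝕜] H₀) (h : H) : EReal :=
  -extendedIntegral μ fun α => ‖A α h‖ ^ 2 * Real.log (‖A α h‖ ^ 2)

/-- The set `H_A` of the unit vectors `h` with `A α h ≠ 0` for all `α`. -/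
def entropyDomain {𝕜 Ω H H₀ : Type*} [RCLike 𝕜]
    [NormedAddCommGroup H] [InnerProductSpace 𝕜 H]
    [NormedAddCommGroup H₀] [InnerProductSpace 𝕜 H₀]
    (A : Ω → H →L[𝕜] H₀) : Set H :=
  {h | ‖h‖ = 1 ∧ ∀ α, A α h ≠ 0}

/-! Upper bound: the tangent line of `t log t` at `1/μ(Ω)` gives Jensen's inequality.

Lower bound: put `p α = A α* A α h`, `q β = B β* B β h`, `f = ‖A α h‖`, `g = ‖B β h‖`. Both families
integrate weakly to `h`, and `|⟪p α, q β⟫| ≤ M f g` with `M = sup ‖B β A α*‖`. Formally `F z = ∬ f^z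
g^z ⟪p, q⟫` satisfies `F 0 = 1`, `|F| ≤ 1` on `Re z = 0` (Bessel) and `|F| ≤ M ∬ f² g² = M` on `Re z
= 1`. The three lines theorem gives `F x ≤ M^x`; differentiating at `0` gives `∫ f² log f + ∫ g² log
g ≤ log M`, and `-2` times this is the claim.

No joint measurability in `(α, β)` is assumed, so the interpolation is done for finite sums
(`sum_mul_add_sum_mul_le_log`). The level sets of `f` and `g` reduce the integrals to such sums
(`exists_finite_partition`). Finitely many levels suffice because `f ≤ M ∫ g` (`le_mul_integral`).
-/

open MeasureTheory

/-! ### Interpolation for finite bilinear sums. -/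

section Discrete

variable {ι κ E : Type*} [Fintype ι] [Fintype κ] [NormedAddCommGroup E] [InnerProductSpace ℝ E]

theorem sum_re_sq_mul_add_sum_im_sq_mul {w : ι → ℂ} (hw : ∀ i, ‖w i‖ = 1) (R : ι → ℝ) :
    ∑ i, (w i).re ^ 2 * R i + ∑ i, (w i).im ^ 2 * R i = ∑ i, R i := by
  rw [← Finset.sum_add_distrib]
  refine Finset.sum_congr rfl fun i _ => ?_
  have := Complex.sq_norm (w i)
  rw [hw i, Complex.normSq_apply] at this
  linear_combination (-R i) * this

/-- A real bilinear form in a real Hilbert space keeps its bound under complex coefficients. -/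
theorem re_sum_mul_inner_le {X : ι → E} {Y : κ → E} {P : ι → ℝ} {Q : κ → ℝ}
    (hX : ∀ c : ι → ℝ, ‖∑ i, c i • X i‖ ^ 2 ≤ ∑ i, c i ^ 2 * P i)
    (hY : ∀ c : κ → ℝ, ‖∑ j, c j • Y j‖ ^ 2 ≤ ∑ j, c j ^ 2 * Q j)
    (hP : ∑ i, P i = 1) (hQ : ∑ j, Q j = 1) {u : ι → ℂ} {v : κ → ℂ}
    (hu : ∀ i, ‖u i‖ = 1) (hv : ∀ j, ‖v j‖ = 1) :
    (∑ i, ∑ j, u i * v j * (inner ℝ (X i) (Y j) : ℝ)).re ≤ 1 := by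
  have key : (∑ i, ∑ j, u i * v j * (inner ℝ (X i) (Y j) : ℝ)).re =
      inner ℝ (∑ i, (u i).re • X i) (∑ j, (v j).re • Y j) -
        inner ℝ (∑ i, (u i).im • X i) (∑ j, (v j).im • Y j) := by
    rw [sum_inner, sum_inner, ← Finset.sum_sub_distrib, Complex.re_sum]
    refine Finset.sum_congr rfl fun i _ => ?_
    rw [inner_sum, inner_sum, ← Finset.sum_sub_distrib, Complex.re_sum]
    refine Finset.sum_congr rfl fun j _ => ?_
    simp only [real_inner_smul_left, real_inner_smul_right, Complex.mul_re, Complex.ofReal_re,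
      Complex.ofReal_im]
    ring
  have h1 := real_inner_le_norm (∑ i, (u i).re • X i) (∑ j, (v j).re • Y j)
  have h2 := neg_le_of_abs_le
    (abs_real_inner_le_norm (∑ i, (u i).im • X i) (∑ j, (v j).im • Y j))
  have := sum_re_sq_mul_add_sum_im_sq_mul hu P
  have := sum_re_sq_mul_add_sum_im_sq_mul hv Q
  rw [key]
  nlinarith [hX fun i => (u i).re, hX fun i => (u i).im, hY fun j => (v j).re,
    hY fun j => (v j).im, sq_nonneg (‖∑ i, (u i).re • X i‖ - ‖∑ j, (v j).re • Y j‖),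
    sq_nonneg (‖∑ i, (u i).im • X i‖ - ‖∑ j, (v j).im • Y j‖)]

/-- The phase `d` that rotates the sum onto its modulus is absorbed into `u`, so the bound on real
parts suffices. -/
theorem norm_sum_mul_inner_le {X : ι → E} {Y : κ → E} {P : ι → ℝ} {Q : κ → ℝ}
    (hX : ∀ c : ι → ℝ, ‖∑ i, c i • X i‖ ^ 2 ≤ ∑ i, c i ^ 2 * P i)
    (hY : ∀ c : κ → ℝ, ‖∑ j, c j • Y j‖ ^ 2 ≤ ∑ j, c j ^ 2 * Q j)
    (hP : ∑ i, P i = 1) (hQ : ∑ j, Q j = 1) {u : ι → ℂ} {v : κ → ℂ}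
    (hu : ∀ i, ‖u i‖ = 1) (hv : ∀ j, ‖v j‖ = 1) :
    ‖∑ i, ∑ j, u i * v j * (inner ℝ (X i) (Y j) : ℝ)‖ ≤ 1 := by
  obtain ⟨c, hc, hcS⟩ := RCLike.exists_norm_mul_eq_self
    (∑ i, ∑ j, u i * v j * ((inner ℝ (X i) (Y j) : ℝ) : ℂ))
  obtain ⟨d, hd, hdS⟩ : ∃ d : ℂ, ‖d‖ = 1 ∧
      d * (∑ i, ∑ j, u i * v j * ((inner ℝ (X i) (Y j) : ℝ) : ℂ)) =
        ‖∑ i, ∑ j, u i * v j * ((inner ℝ (X i) (Y j) : ℝ) : ℂ)‖ := by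
    refine ⟨(starRingEnd ℂ) c, by simpa using hc, ?_⟩
    conv_lhs => rw [← hcS]
    rw [← mul_assoc, RCLike.conj_mul, hc]
    simp
  have := re_sum_mul_inner_le hX hY hP hQ (u := fun i => d * u i) (by simpa [hd] using hu) hv
  simp only [mul_assoc, ← Finset.mul_sum] at this hdS ⊢
  rwa [hdS, Complex.ofReal_re] at this

/-- The finite form of the entropic uncertainty principle: complex interpolation between the
`ℓ²`-bound and the `ℓ¹`-bound of the form `⟪X i, Y j⟫`, differentiated at the `ℓ²` end. -/
theorem sum_mul_add_sum_mul_le_log {X : ι → E} {Y : κ → E} {h : E} (hh : ‖h‖ = 1)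
    (hX : ∀ c : ι → ℝ, ‖∑ i, c i • X i‖ ^ 2 ≤ ∑ i, c i ^ 2 * inner ℝ (X i) h)
    (hY : ∀ c : κ → ℝ, ‖∑ j, c j • Y j‖ ^ 2 ≤ ∑ j, c j ^ 2 * inner ℝ (Y j) h)
    (hXh : ∑ i, X i = h) (hYh : ∑ j, Y j = h) {M : ℝ} {a : ι → ℝ} {b : κ → ℝ}
    (hM : ∀ i j, |inner ℝ (X i) (Y j)| ≤ M * a i * b j) (l : ι → ℝ) (m : κ → ℝ)
    {C : ℝ} (hC : 0 < C)
    (hlm : M * (∑ i, Real.exp (l i) * a i) * (∑ j, Real.exp (m j) * b j) ≤ C) :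
    ∑ i, l i * inner ℝ (X i) h + ∑ j, m j * inner ℝ (Y j) h ≤ Real.log C := by
  have hP : ∑ i, inner ℝ (X i) h = 1 := by rw [← sum_inner, hXh]; simp [hh]
  have hQ : ∑ j, inner ℝ (Y j) h = 1 := by rw [← sum_inner, hYh]; simp [hh]
  set F : ℂ → ℂ := fun z => ∑ i, ∑ j,
    Complex.exp (z * (l i : ℂ)) * Complex.exp (z * (m j : ℂ)) * (inner ℝ (X i) (Y j) : ℝ) with hF
  have hnorm (z : ℂ) (r : ℝ) : ‖Complex.exp (z * (r : ℂ))‖ = Real.exp (z.re * r) := by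
    rw [Complex.norm_exp]; simp
  have hdiff : Differentiable ℂ F := by fun_prop
  have hbdd : BddAbove ((norm ∘ F) '' Complex.HadamardThreeLines.verticalClosedStrip 0 1) := by
    refine ⟨∑ i, ∑ j, Real.exp |l i| * Real.exp |m j| * |inner ℝ (X i) (Y j)|, ?_⟩
    rintro _ ⟨z, hz, rfl⟩
    have hz' : 0 ≤ z.re ∧ z.re ≤ 1 := hz
    have hle (r : ℝ) : z.re * r ≤ |r| := by
      nlinarith [le_abs_self r, abs_nonneg r]
    refine (norm_sum_le _ _).trans (Finset.sum_le_sum fun i _ =>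
      (norm_sum_le _ _).trans (Finset.sum_le_sum fun j _ => ?_))
    rw [norm_mul, norm_mul, hnorm, hnorm, Complex.norm_real, Real.norm_eq_abs]
    gcongr <;> exact hle _
  have h0 : ∀ z ∈ Complex.re ⁻¹' {(0 : ℝ)}, ‖F z‖ ≤ 1 := by
    intro z hz
    have hz : z.re = 0 := hz
    exact norm_sum_mul_inner_le hX hY hP hQ (fun i => by simp [hnorm, hz])
      (fun j => by simp [hnorm, hz])
  have h1 : ∀ z ∈ Complex.re ⁻¹' {(1 : ℝ)}, ‖F z‖ ≤ C := by
    intro z hz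
    have hz : z.re = 1 := hz
    refine le_trans ?_ hlm
    rw [mul_assoc, Finset.sum_mul_sum, Finset.mul_sum]
    refine (norm_sum_le _ _).trans (Finset.sum_le_sum fun i _ => ?_)
    rw [Finset.mul_sum]
    refine (norm_sum_le _ _).trans (Finset.sum_le_sum fun j _ => ?_)
    rw [norm_mul, norm_mul, hnorm, hnorm, Complex.norm_real, Real.norm_eq_abs, hz, one_mul,
      one_mul]
    calc _ ≤ Real.exp (l i) * Real.exp (m j) * (M * a i * b j) := by gcongr; exact hM i j
      _ = _ := by ring
  have hint (x : ℝ) (hx : 0 ≤ x) (hx1 : x ≤ 1) : (F x).re ≤ C ^ x := by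
    have := Complex.HadamardThreeLines.norm_le_interp_of_mem_verticalClosedStrip' (f := F)
      (z := (x : ℂ)) zero_lt_one ⟨by simpa using hx, by simpa using hx1⟩ hdiff.diffContOnCl hbdd h0 h1
    simp only [Complex.ofReal_re, Real.one_rpow, one_mul, sub_zero, div_one] at this
    exact (Complex.re_le_norm _).trans this
  -- `G ≥ 0` on `[0, 1]` and `G 0 = 0`, so its derivative at `0` is nonnegative; this is the claim.
  set G : ℝ → ℝ := fun x => C ^ x - ∑ i, ∑ j,
    Real.exp (x * (l i + m j)) * inner ℝ (X i) (Y j) with hG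
  have hFG (x : ℝ) : G x = C ^ x - (F x).re := by
    simp only [hG, hF, Complex.re_sum, Complex.re_mul_ofReal, ← Complex.exp_add]
    norm_cast
    simp only [mul_add]
  have hG0 : G 0 = 0 := by
    simp only [hG, zero_mul, Real.exp_zero, one_mul, Real.rpow_zero, ← inner_sum, ← sum_inner,
      hXh, hYh]
    simp [hh]
  have hd : HasDerivAt G (Real.log C - ∑ i, ∑ j, (l i + m j) * inner ℝ (X i) (Y j)) 0 := by
    have e1 : HasDerivAt (fun x : ℝ => C ^ x) (Real.log C) 0 := by
      simpa using (hasDerivAt_id (0 : ℝ)).const_rpow hC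
    refine e1.sub (HasDerivAt.fun_sum fun i _ => HasDerivAt.fun_sum fun j _ => ?_)
    simpa using (((hasDerivAt_id (0 : ℝ)).mul_const (l i + m j)).exp).mul_const
      (inner ℝ (X i) (Y j))
  have hlim := hd.tendsto_slope_zero_right
  have hnn := ge_of_tendsto hlim (b := 0) (by
    filter_upwards [Ioc_mem_nhdsGT (zero_lt_one' ℝ)] with t ht
    rw [zero_add, hG0, sub_zero, hFG, smul_eq_mul]
    exact mul_nonneg (inv_nonneg.2 ht.1.le) (sub_nonneg.2 (hint t ht.1.le ht.2)))
  have hsum : ∑ i, ∑ j, (l i + m j) * inner ℝ (X i) (Y j) =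
      ∑ i, l i * inner ℝ (X i) h + ∑ j, m j * inner ℝ (Y j) h := by
    simp only [add_mul, Finset.sum_add_distrib]
    congr 1
    · simp only [← Finset.mul_sum, ← inner_sum, hYh]
    · rw [Finset.sum_comm]
      simp only [← Finset.mul_sum, ← sum_inner, hXh, real_inner_comm h]
  linarith

end Discrete

/-! ### Weak resolutions of a vector and their discretization. -/

/-- The real content of a Parseval frame at a vector `h`: with `p α = A α* A α h` and
`f α = ‖A α h‖`, the vectors `p α` integrate weakly to `h` and are dominated by `f` in the `L²`
sense. -/
structure IsWeakResolution {Ω E : Type*} [MeasurableSpace Ω] [NormedAddCommGroup E]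
    [InnerProductSpace ℝ E] (μ : Measure Ω) (p : Ω → E) (f : Ω → ℝ) (h : E) : Prop where
  integrable_inner : ∀ k, Integrable (fun α => inner ℝ (p α) k) μ
  integral_inner : ∀ k, ∫ α, inner ℝ (p α) k ∂μ = inner ℝ h k
  abs_inner_le : ∀ k, ∃ g : Ω → ℝ, Integrable (fun α => g α ^ 2) μ ∧
    ∫ α, g α ^ 2 ∂μ = ‖k‖ ^ 2 ∧ ∀ α, |inner ℝ (p α) k| ≤ f α * g α
  inner_self : ∀ α, inner ℝ (p α) h = f α ^ 2
  pos : ∀ α, 0 < f α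

namespace IsWeakResolution

variable {Ω E : Type*} [MeasurableSpace Ω] [NormedAddCommGroup E] [InnerProductSpace ℝ E]
  {μ : Measure Ω} {p : Ω → E} {f : Ω → ℝ} {h : E}

theorem integrable_sq (hp : IsWeakResolution μ p f h) : Integrable (fun α => f α ^ 2) μ := by
  simpa only [hp.inner_self] using hp.integrable_inner h

theorem integral_sq (hp : IsWeakResolution μ p f h) : ∫ α, f α ^ 2 ∂μ = ‖h‖ ^ 2 := by
  simpa only [hp.inner_self, real_inner_self_eq_norm_sq] using hp.integral_inner h

theorem aestronglyMeasurable (hp : IsWeakResolution μ p f h) : AEStronglyMeasurable f μ := by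
  have := Real.continuous_sqrt.comp_aestronglyMeasurable hp.integrable_sq.aestronglyMeasurable
  simpa only [Real.sqrt_sq (hp.pos _).le] using this

theorem integrable [IsFiniteMeasure μ] (hp : IsWeakResolution μ p f h) : Integrable f μ := by
  refine (hp.integrable_sq.add (integrable_const 1)).mono' hp.aestronglyMeasurable (ae_of_all _ ?_)
  intro α
  rw [Real.norm_eq_abs, abs_of_pos (hp.pos α)]
  simp only [Pi.add_apply]
  nlinarith [sq_nonneg (f α - 1), hp.pos α]

/-- Weighted weak integrals of the family `p` exist. -/
theorem exists_inner_eq_integral [CompleteSpace E] (hp : IsWeakResolution μ p f h) {w : Ω → ℝ}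
    (hw : AEStronglyMeasurable w μ) (hw1 : ∀ α, |w α| ≤ 1) :
    ∃ X : E, ∀ k, inner ℝ X k = ∫ α, w α * inner ℝ (p α) k ∂μ := by
  have hint (k : E) : Integrable (fun α => w α * inner ℝ (p α) k) μ :=
    (hp.integrable_inner k).bdd_mul (c := 1) hw (ae_of_all _ hw1)
  let φ : E →ₗ[ℝ] ℝ :=
    { toFun := fun k => ∫ α, w α * inner ℝ (p α) k ∂μ
      map_add' := fun k k' => by
        simp only [inner_add_right, mul_add]
        exact integral_add (hint k) (hint k')
      map_smul' := fun c k => by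
        simp only [real_inner_smul_right, RingHom.id_apply, smul_eq_mul, ← integral_const_mul]
        exact integral_congr_ae (ae_of_all _ fun α => by ring) }
  have hφ : ∃ C, ∀ k, ‖φ k‖ ≤ C * ‖k‖ := by
    -- The constant comes from `f g ≤ (f² + g²) / 2` and `∫ g² = ‖k‖² ≤ 1` on the unit ball.
    refine φ.bound_of_ball_bound zero_lt_one ((∫ α, f α ^ 2 ∂μ + 1) / 2) fun k hk => ?_
    obtain ⟨g, hg, hgk, hpg⟩ := hp.abs_inner_le k
    have hk : ‖k‖ < 1 := by simpa using hk
    have : ‖φ k‖ ≤ ∫ α, (f α ^ 2 + g α ^ 2) / 2 ∂μ := by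
      refine norm_integral_le_of_norm_le ((hp.integrable_sq.add hg).div_const 2)
        (ae_of_all _ fun α => ?_)
      rw [Real.norm_eq_abs, abs_mul]
      have := mul_le_mul (hw1 α) (hpg α) (abs_nonneg _) zero_le_one
      nlinarith [sq_nonneg (f α - g α)]
    rw [integral_div, integral_add hp.integrable_sq hg, hgk] at this
    nlinarith [norm_nonneg k]
  refine ⟨(InnerProductSpace.toDual ℝ E).symm (φ.mkContinuousOfExistsBound hφ), fun k => ?_⟩
  rw [InnerProductSpace.toDual_symm_apply]
  rfl

/-- A weighted weak integral of `p` is bounded by the `L²`-norm of the weight times `f`. -/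
theorem norm_sq_le_integral (hp : IsWeakResolution μ p f h) {w : Ω → ℝ}
    (hw : Integrable (fun α => w α ^ 2 * f α ^ 2) μ) {X : E}
    (hX : inner ℝ X X = ∫ α, w α * inner ℝ (p α) X ∂μ) :
    ‖X‖ ^ 2 ≤ ∫ α, w α ^ 2 * f α ^ 2 ∂μ := by
  obtain ⟨g, hg, hgX, hpg⟩ := hp.abs_inner_le X
  -- The left side is `‖X‖²` and `∫ g² = ‖X‖²`, so half of `‖X‖²` is absorbed on the left.
  have : ‖∫ α, w α * inner ℝ (p α) X ∂μ‖ ≤ ∫ α, (w α ^ 2 * f α ^ 2 + g α ^ 2) / 2 ∂μ := by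
    refine norm_integral_le_of_norm_le ((hw.add hg).div_const 2) (ae_of_all _ fun α => ?_)
    rw [Real.norm_eq_abs, abs_mul]
    have h1 := mul_le_mul_of_nonneg_left (hpg α) (abs_nonneg (w α))
    nlinarith [sq_nonneg (|w α| * f α - g α), sq_abs (w α)]
  rw [integral_div, integral_add hw hg, hgX, ← hX, real_inner_self_eq_norm_sq, Real.norm_eq_abs,
    abs_of_nonneg (sq_nonneg _)] at this
  linarith

theorem integrable_sq_mul_log [IsFiniteMeasure μ] (hp : IsWeakResolution μ p f h) {R : ℝ}
    (hR : ∀ α, f α ≤ R) : Integrable (fun α => f α ^ 2 * Real.log (f α)) μ := by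
  have hc : Continuous fun t : ℝ => t * (t * Real.log t) :=
    continuous_id.mul Real.continuous_mul_log
  obtain ⟨C, hC⟩ := (isCompact_Icc (a := (0 : ℝ)) (b := R)).exists_bound_of_continuousOn
    hc.continuousOn
  have h1 : (fun α => f α ^ 2 * Real.log (f α)) = fun α => f α * (f α * Real.log (f α)) := by
    ext α; ring
  rw [h1]
  exact Integrable.of_bound (hc.comp_aestronglyMeasurable hp.aestronglyMeasurable) C
    (ae_of_all _ fun α => hC _ ⟨(hp.pos α).le, hR α⟩)

/-- A weak resolution with bounded `f`, cut into finitely many pieces according to the size of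
`f`. -/
theorem exists_finite_partition [CompleteSpace E] [IsFiniteMeasure μ]
    (hp : IsWeakResolution μ p f h) (hh : ‖h‖ = 1) {R : ℝ} (hR : ∀ α, f α ≤ R) {ε : ℝ}
    (hε : 0 < ε) :
    ∃ (N : ℕ) (X : Fin N → E) (a l : Fin N → ℝ),
      (∀ c : Fin N → ℝ, ‖∑ i, c i • X i‖ ^ 2 ≤ ∑ i, c i ^ 2 * inner ℝ (X i) h) ∧
      ∑ i, X i = h ∧
      (∀ (k : E) (c : ℝ), (∀ α, |inner ℝ (p α) k| ≤ c * f α) →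
        ∀ i, |inner ℝ (X i) k| ≤ c * a i) ∧
      0 ≤ ∑ i, Real.exp (l i) * a i ∧
      ∑ i, Real.exp (l i) * a i ≤ 1 + ε * ∫ α, f α ∂μ ∧
      ∫ α, f α ^ 2 * Real.log (f α) ∂μ ≤ ∑ i, l i * inner ℝ (X i) h := by
  set n : Ω → ℕ := fun α => ⌊f α / ε⌋₊ with hn
  set N : ℕ := ⌊R / ε⌋₊ + 1 with hN
  have hnN (α : Ω) : n α < N := by
    rw [hN, Nat.lt_succ_iff]
    exact Nat.floor_mono (by have := hR α; gcongr)
  set χ : Fin N → Ω → ℝ := fun i α => if n α = i then 1 else 0 with hχ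
  -- Exactly one piece contains `α`, so sums over pieces become integrals of functions of `n α`.
  have hsum (c : ℕ → ℝ) (α : Ω) : ∑ i : Fin N, c i * χ i α = c (n α) := by
    rw [Finset.sum_eq_single (⟨n α, hnN α⟩ : Fin N)]
    · simp [hχ]
    · intro i _ hi
      have : n α ≠ i := fun h => hi (Fin.ext h.symm)
      simp [hχ, this]
    · simp
  have hχ01 (i : Fin N) (α : Ω) : χ i α = 0 ∨ χ i α = 1 := by
    by_cases hi : n α = i <;> simp [hχ, hi]
  have hχ1 (i : Fin N) (α : Ω) : |χ i α| ≤ 1 := by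
    rcases hχ01 i α with h | h <;> simp [h]
  have hχ0 (i : Fin N) (α : Ω) : 0 ≤ χ i α := by
    rcases hχ01 i α with h | h <;> simp [h]
  have hnm : AEMeasurable n μ :=
    Nat.measurable_floor.comp_aemeasurable (hp.aestronglyMeasurable.aemeasurable.div_const ε)
  have hχm (i : Fin N) : AEStronglyMeasurable (χ i) μ :=
    ((measurable_of_countable fun j : ℕ => if j = i then (1 : ℝ) else 0).comp_aemeasurable
      hnm).aestronglyMeasurable
  have hint {φ : Ω → ℝ} (hφ : Integrable φ μ) (i : Fin N) :
      Integrable (fun α => χ i α * φ α) μ :=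
    hφ.bdd_mul (c := 1) (hχm i) (ae_of_all _ (hχ1 i))
  have hintc {φ : Ω → ℝ} (hφ : Integrable φ μ) (c : ℕ → ℝ) :
      Integrable (fun α => c (n α) * φ α) μ := by
    have := integrable_finsetSum Finset.univ fun i _ => (hint hφ i).const_mul (c (i : Fin N))
    simpa only [← mul_assoc, ← Finset.sum_mul, hsum] using this
  have hintegral {φ : Ω → ℝ} (hφ : Integrable φ μ) (c : ℕ → ℝ) :
      ∑ i : Fin N, c i * ∫ α, χ i α * φ α ∂μ = ∫ α, c (n α) * φ α ∂μ := by
    simp only [← integral_const_mul]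
    rw [← integral_finsetSum _ fun i _ => (hint hφ i).const_mul _]
    simp only [← mul_assoc, ← Finset.sum_mul, hsum]
  choose X hX using fun i => hp.exists_inner_eq_integral (hχm i) (hχ1 i)
  have hXh (i : Fin N) : inner ℝ (X i) h = ∫ α, χ i α * f α ^ 2 ∂μ := by
    simp only [hX, hp.inner_self]
  have hlow (α : Ω) : f α ≤ ε * (n α + 1) := by
    have := (Nat.lt_floor_add_one (f α / ε)).le
    rw [div_le_iff₀ hε] at this
    linarith
  have hupp (α : Ω) : ε * (n α + 1) ≤ f α + ε := by
    have := Nat.floor_le (div_nonneg (hp.pos α).le hε.le)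
    rw [le_div_iff₀ hε] at this
    linarith
  have hexp (j : ℕ) : Real.exp (Real.log (ε * (j + 1))) = ε * (j + 1) :=
    Real.exp_log (by positivity)
  -- `exp (l i)` is the upper end of the level, hence positive even for `i = 0`, and `f ≤ exp (l i)
  -- ≤ f + ε` on the piece: the left inequality bounds the entropy integral, the right one the sum
  -- of `exp (l i) * a i`.
  refine ⟨N, X, fun i => ∫ α, χ i α * f α ∂μ, fun i => Real.log (ε * ((i : ℕ) + 1)),
    fun c => ?_, ?_, fun k c hc i => ?_, ?_, ?_, ?_⟩
  · set d : ℕ → ℝ := fun j => if hj : j < N then c ⟨j, hj⟩ else 0 with hd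
    have hcd (i : Fin N) : c i = d i := by simp [hd]
    simp only [hcd, hXh]
    rw [hintegral hp.integrable_sq fun j => d j ^ 2]
    refine hp.norm_sq_le_integral (hintc hp.integrable_sq fun j => d j ^ 2) ?_
    conv_lhs => rw [sum_inner]
    simp only [real_inner_smul_left, hX]
    exact hintegral (hp.integrable_inner _) d
  · refine ext_inner_right ℝ fun k => ?_
    rw [sum_inner, ← hp.integral_inner]
    simpa [hX] using hintegral (hp.integrable_inner k) fun _ => 1
  · rw [hX, ← integral_const_mul, ← Real.norm_eq_abs]
    refine norm_integral_le_of_norm_le ((hint hp.integrable i).const_mul c) (ae_of_all _ ?_)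
    intro α
    rw [norm_mul, Real.norm_of_nonneg (hχ0 i α), Real.norm_eq_abs, mul_left_comm]
    exact mul_le_mul_of_nonneg_left (hc α) (hχ0 i α)
  · exact Finset.sum_nonneg fun i _ => mul_nonneg (Real.exp_pos _).le
      (integral_nonneg fun α => mul_nonneg (hχ0 i α) (hp.pos α).le)
  · simp only [hexp]
    have h1 : 1 + ε * ∫ α, f α ∂μ = ∫ α, (f α ^ 2 + ε * f α) ∂μ := by
      rw [integral_add hp.integrable_sq (hp.integrable.const_mul ε), hp.integral_sq, hh, one_pow,
        integral_const_mul]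
    rw [hintegral hp.integrable fun j => ε * (j + 1), h1]
    refine integral_mono (hintc hp.integrable fun j => ε * (j + 1))
      (hp.integrable_sq.add (hp.integrable.const_mul ε)) fun α => ?_
    have := mul_le_mul_of_nonneg_right (hupp α) (hp.pos α).le
    linarith
  · simp only [hXh]
    rw [hintegral hp.integrable_sq fun j => Real.log (ε * (j + 1))]
    refine integral_mono (hp.integrable_sq_mul_log hR)
      (hintc hp.integrable_sq fun j => Real.log (ε * (j + 1))) fun α => ?_
    simp only
    rw [mul_comm]
    exact mul_le_mul_of_nonneg_right (Real.log_le_log (hp.pos α) (hlow α)) (sq_nonneg _)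

variable {Δ : Type*} [MeasurableSpace Δ] {ν : Measure Δ} {q : Δ → E} {g : Δ → ℝ} {M : ℝ}

/-- Expand `f α ^ 2 = ⟪p α, h⟫` as `∫ ⟪q β, p α⟫ ≤ M f α ∫ g` and divide by `f α`. -/
theorem le_mul_integral [IsFiniteMeasure ν] (hp : IsWeakResolution μ p f h)
    (hq : IsWeakResolution ν q g h)
    (hM : ∀ α β, |inner ℝ (p α) (q β)| ≤ M * f α * g β) (α : Ω) : f α ≤ M * ∫ β, g β ∂ν := by
  have h1 : ‖∫ β, inner ℝ (q β) (p α) ∂ν‖ ≤ ∫ β, M * f α * g β ∂ν :=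
    norm_integral_le_of_norm_le (hq.integrable.const_mul _) (ae_of_all _ fun β => by
      rw [real_inner_comm]; exact hM α β)
  rw [hq.integral_inner, real_inner_comm, hp.inner_self, integral_const_mul, Real.norm_eq_abs,
    abs_of_nonneg (sq_nonneg _)] at h1
  refine le_of_mul_le_mul_left ?_ (hp.pos α)
  linarith

/-- The entropic uncertainty principle for two weak resolutions of one unit vector. -/
theorem integral_sq_mul_log_add_le_log [CompleteSpace E] [IsFiniteMeasure μ] [IsFiniteMeasure ν]
    (hp : IsWeakResolution μ p f h) (hq : IsWeakResolution ν q g h) (hh : ‖h‖ = 1)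
    (hM0 : 0 < M) (hM : ∀ α β, |inner ℝ (p α) (q β)| ≤ M * f α * g β) :
    ∫ α, f α ^ 2 * Real.log (f α) ∂μ + ∫ β, g β ^ 2 * Real.log (g β) ∂ν ≤ Real.log M := by
  have hf0 : 0 ≤ ∫ α, f α ∂μ := integral_nonneg fun α => (hp.pos α).le
  have hg0 : 0 ≤ ∫ β, g β ∂ν := integral_nonneg fun β => (hq.pos β).le
  have hM' (β : Δ) (α : Ω) : |inner ℝ (q β) (p α)| ≤ M * g β * f α := by
    rw [real_inner_comm, mul_right_comm]
    exact hM α β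
  have key : ∀ ε > 0, ∫ α, f α ^ 2 * Real.log (f α) ∂μ + ∫ β, g β ^ 2 * Real.log (g β) ∂ν ≤
      Real.log (M * (1 + ε * ∫ α, f α ∂μ) * (1 + ε * ∫ β, g β ∂ν)) := by
    intro ε hε
    obtain ⟨N, X, a, l, hX, hXh, hXk, ha, hae, hl⟩ :=
      hp.exists_finite_partition hh (hp.le_mul_integral hq hM) hε
    obtain ⟨N', Y, b, m, hY, hYh, hYk, hb, hbe, hm⟩ :=
      hq.exists_finite_partition hh (hq.le_mul_integral hp hM') hε
    refine (add_le_add hl hm).trans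
      (sum_mul_add_sum_mul_le_log (M := M) (a := a) (b := b) hh hX hY hXh hYh ?_ l m
        (by positivity) (by gcongr))
    intro i j
    -- The pointwise bound passes through the weak integrals one at a time: over `β` with `α` fixed,
    -- then over `α`.
    have := hXk (Y j) (M * b j) (fun α => ?_) i
    · rwa [mul_right_comm]
    · rw [real_inner_comm, mul_right_comm]
      exact hYk (p α) (M * f α) (fun β => by rw [real_inner_comm]; exact hM α β) j
  have hlim : Filter.Tendsto (fun ε : ℝ =>
      Real.log (M * (1 + ε * ∫ α, f α ∂μ) * (1 + ε * ∫ β, g β ∂ν)))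
      (nhdsWithin 0 (Set.Ioi 0)) (nhds (Real.log M)) := by
    have hc : ContinuousAt (fun ε : ℝ =>
        Real.log (M * (1 + ε * ∫ α, f α ∂μ) * (1 + ε * ∫ β, g β ∂ν))) 0 := by
      refine ContinuousAt.log (by fun_prop) (by simpa using hM0.ne')
    have := hc.tendsto.mono_left (nhdsWithin_le_nhds (s := Set.Ioi 0))
    simpa using this
  exact ge_of_tendsto hlim (by filter_upwards [self_mem_nhdsWithin] with ε hε using key ε hε)

/-- The bound `M` cannot vanish. -/
theorem bound_pos [IsFiniteMeasure ν] (hp : IsWeakResolution μ p f h)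
    (hq : IsWeakResolution ν q g h) (hh : ‖h‖ = 1)
    (hM : ∀ α β, |inner ℝ (p α) (q β)| ≤ M * f α * g β) : 0 < M := by
  have hg0 : 0 ≤ ∫ β, g β ∂ν := integral_nonneg fun β => (hq.pos β).le
  have hne : Nonempty Ω := by
    by_contra hne
    rw [not_nonempty_iff] at hne
    have := hp.integral_sq
    simp [hh, integral_of_isEmpty] at this
  obtain ⟨α⟩ := hne
  by_contra hM0
  have := hp.le_mul_integral hq hM α
  nlinarith [hp.pos α]

end IsWeakResolution

/-! ### From Parseval frames to weak resolutions and entropies. -/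

namespace IsOperatorValuedParsevalFrame

variable {𝕜 Ω H H₀ : Type*} [RCLike 𝕜] [MeasurableSpace Ω] [NormedAddCommGroup H]
  [InnerProductSpace 𝕜 H] [NormedAddCommGroup H₀] [InnerProductSpace 𝕜 H₀] {μ : Measure Ω}
  {A : Ω → H →L[𝕜] H₀}

/-- Polarization carries the Parseval identity and its integrability from squared norms to inner
products. -/
theorem re_inner_eq (x y : H₀) :
    RCLike.re (inner 𝕜 x y) = (‖x + y‖ ^ 2 - ‖x‖ ^ 2 - ‖y‖ ^ 2) / 2 := by
  rw [norm_add_sq (𝕜 := 𝕜)]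
  ring

theorem integrable_re_inner (hA : IsOperatorValuedParsevalFrame μ A) (h k : H) :
    Integrable (fun α => RCLike.re (inner 𝕜 (A α h) (A α k))) μ := by
  simp only [re_inner_eq, ← map_add]
  exact (((hA.integrable_norm_sq _).sub (hA.integrable_norm_sq _)).sub
    (hA.integrable_norm_sq _)).div_const 2

theorem integral_re_inner (hA : IsOperatorValuedParsevalFrame μ A) (h k : H) :
    ∫ α, RCLike.re (inner 𝕜 (A α h) (A α k)) ∂μ = RCLike.re (inner 𝕜 h k) := by
  simp only [re_inner_eq, ← map_add]
  have hi := hA.integrable_norm_sq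
  rw [integral_div, integral_sub (f := fun α => ‖A α (h + k)‖ ^ 2 - ‖A α h‖ ^ 2)
    ((hi _).sub (hi _)) (hi _), integral_sub (hi _) (hi _), ← hA.norm_sq_eq, ← hA.norm_sq_eq,
    ← hA.norm_sq_eq]

/-- Restricting scalars to `ℝ` treats both fields at once. Domination is Cauchy–Schwarz for `⟪A α h,
A α k⟫`, with `g α = ‖A α k‖`. -/
theorem isWeakResolution [CompleteSpace H] [CompleteSpace H₀]
    (hA : IsOperatorValuedParsevalFrame μ A) {h : H} (hh : ∀ α, A α h ≠ 0) :
    @IsWeakResolution Ω H _ _ (InnerProductSpace.rclikeToReal 𝕜 H) μ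
      (fun α => ContinuousLinearMap.adjoint (A α) (A α h)) (fun α => ‖A α h‖) h := by
  let _ := InnerProductSpace.rclikeToReal 𝕜 H
  have key (α : Ω) (k : H) : inner ℝ (ContinuousLinearMap.adjoint (A α) (A α h)) k =
      RCLike.re (inner 𝕜 (A α h) (A α k)) := by
    rw [real_inner_eq_re_inner 𝕜, ContinuousLinearMap.adjoint_inner_left]
  refine ⟨fun k => ?_, fun k => ?_, fun k => ⟨fun α => ‖A α k‖, hA.integrable_norm_sq k,
    (hA.norm_sq_eq k).symm, fun α => ?_⟩, fun α => ?_, fun α => norm_pos_iff.2 (hh α)⟩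
  · simpa only [key] using hA.integrable_re_inner h k
  · simpa only [key, real_inner_eq_re_inner 𝕜] using hA.integral_re_inner h k
  · rw [key]
    exact (RCLike.abs_re_le_norm _).trans (norm_inner_le_norm _ _)
  · rw [key, inner_self_eq_norm_sq]

theorem abs_re_inner_adjoint_le [CompleteSpace H] [CompleteSpace H₀] (S T : H →L[𝕜] H₀) (x y : H₀)
    {M : ℝ} (hM : ‖T ∘L ContinuousLinearMap.adjoint S‖ ≤ M) :
    |RCLike.re (inner 𝕜 (ContinuousLinearMap.adjoint S x) (ContinuousLinearMap.adjoint T y))| ≤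
      M * ‖x‖ * ‖y‖ := by
  rw [ContinuousLinearMap.adjoint_inner_right]
  refine (RCLike.abs_re_le_norm _).trans ((norm_inner_le_norm _ _).trans ?_)
  have := (T ∘L ContinuousLinearMap.adjoint S).le_of_opNorm_le hM x
  rw [ContinuousLinearMap.comp_apply] at this
  gcongr

/-- The entropy of a unit vector is at most the logarithm of the total mass. -/
theorem continuousShannonEntropy_le_log [IsFiniteMeasure μ]
    (hA : IsOperatorValuedParsevalFrame μ A) {h : H} (hh : ‖h‖ = 1) :
    continuousShannonEntropy μ A h ≤ ENNReal.log (μ Set.univ) := by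
  set t : Ω → ℝ := fun α => ‖A α h‖ ^ 2 with ht
  set m : ℝ := (μ Set.univ).toReal with hm
  have hint : Integrable t μ := hA.integrable_norm_sq h
  have ht1 : ∫ α, t α ∂μ = 1 := by rw [ht, ← hA.norm_sq_eq, hh, one_pow]
  have hμ0 : μ Set.univ ≠ 0 := by
    intro h0
    rw [Measure.measure_univ_eq_zero.1 h0] at ht1
    simp at ht1
  have hm0 : 0 < m := ENNReal.toReal_pos hμ0 (measure_ne_top _ _)
  have hlog : ENNReal.log (μ Set.univ) = ((Real.log m : ℝ) : EReal) :=
    ENNReal.log_pos_real hμ0 (measure_ne_top _ _)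
  have hmeas : AEStronglyMeasurable (fun α => t α * Real.log (t α)) μ :=
    Real.continuous_mul_log.comp_aestronglyMeasurable hint.aestronglyMeasurable
  -- The tangent line of `t log t` at `t = 1/m`, which integrates to `-log m`.
  have hlow (α : Ω) : t α * (1 - Real.log m) - m⁻¹ ≤ t α * Real.log (t α) := by
    rcases (show 0 ≤ t α by positivity).eq_or_lt with h0 | h0
    · rw [← h0]
      have := inv_pos.2 hm0
      linarith
    · have := Real.log_le_sub_one_of_pos (x := (m * t α)⁻¹) (by positivity)
      rw [Real.log_inv, Real.log_mul hm0.ne' h0.ne'] at this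
      have h1 : t α * (m * t α)⁻¹ = m⁻¹ := by field_simp
      nlinarith
  have hlowint : Integrable (fun α => t α * (1 - Real.log m) - m⁻¹) μ :=
    (hint.mul_const _).sub (integrable_const _)
  rw [continuousShannonEntropy]
  by_cases hφ : Integrable (fun α => t α * Real.log (t α)) μ
  · have := integral_mono hlowint hφ hlow
    rw [integral_sub (hint.mul_const _) (integrable_const _), integral_mul_const, ht1,
      integral_const, smul_eq_mul, Measure.real, ← hm, mul_inv_cancel₀ hm0.ne'] at this
    rw [extendedIntegral_eq_integral hφ, hlog, ← EReal.coe_neg, EReal.coe_le_coe_iff]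
    linarith
  -- The negative part is finite by `hlow`, so the positive part is infinite and the entropy is
  -- `-∞`.
  · have hneg : ∫⁻ α, ENNReal.ofReal (-(t α * Real.log (t α))) ∂μ ≠ ⊤ := by
      refine ne_top_of_le_ne_top hlowint.neg.lintegral_lt_top.ne (lintegral_mono fun α => ?_)
      exact ENNReal.ofReal_le_ofReal (neg_le_neg (hlow α))
    have hpos : ∫⁻ α, ENNReal.ofReal (t α * Real.log (t α)) ∂μ = ⊤ := by
      by_contra hpos
      refine hφ ⟨hmeas, ?_⟩
      rw [hasFiniteIntegral_iff_norm]
      refine lt_of_le_of_lt ?_ (ENNReal.add_lt_top.2 ⟨lt_top_iff_ne_top.2 hpos,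
        lt_top_iff_ne_top.2 hneg⟩)
      rw [← lintegral_add_left' hmeas.aemeasurable.ennreal_ofReal]
      refine lintegral_mono fun α => ?_
      rw [Real.norm_eq_abs]
      rcases abs_cases (t α * Real.log (t α)) with h1 | h1 <;> rw [h1.1]
      · exact le_self_add
      · exact le_add_self
    have : extendedIntegral μ (fun α => ‖A α h‖ ^ 2 * Real.log (‖A α h‖ ^ 2)) = ⊤ := by
      rw [extendedIntegral, hpos, EReal.coe_ennreal_top, EReal.top_sub]
      exact EReal.coe_ennreal_eq_top_iff.not.2 hneg
    rw [this]
    simp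

/-- The entropy is a finite Bochner integral when the coefficients are bounded. -/
theorem continuousShannonEntropy_eq [CompleteSpace H] [CompleteSpace H₀] [IsFiniteMeasure μ]
    (hA : IsOperatorValuedParsevalFrame μ A) {h : H} (hh : ∀ α, A α h ≠ 0) {R : ℝ}
    (hR : ∀ α, ‖A α h‖ ≤ R) :
    continuousShannonEntropy μ A h =
      ((-2 * ∫ α, ‖A α h‖ ^ 2 * Real.log ‖A α h‖ ∂μ : ℝ) : EReal) := by
  let _ := InnerProductSpace.rclikeToReal 𝕜 H
  have hint := ((hA.isWeakResolution hh).integrable_sq_mul_log hR).const_mul 2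
  have heq (α : Ω) : ‖A α h‖ ^ 2 * Real.log (‖A α h‖ ^ 2) =
      2 * (‖A α h‖ ^ 2 * Real.log ‖A α h‖) := by
    rw [Real.log_pow]
    push_cast
    ring
  rw [continuousShannonEntropy]
  simp only [heq]
  rw [extendedIntegral_eq_integral hint, integral_const_mul, ← EReal.coe_neg, neg_mul]

end IsOperatorValuedParsevalFrame

theorem theorem2p3 {𝕜 Ω Δ H H₀ : Type*} [RCLike 𝕜]
    [MeasurableSpace Ω] (μ : Measure Ω) [IsFiniteMeasure μ]
    [MeasurableSpace Δ] (ν : Measure Δ) [IsFiniteMeasure ν]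
    [NormedAddCommGroup H] [InnerProductSpace 𝕜 H] [CompleteSpace H]
    [NormedAddCommGroup H₀] [InnerProductSpace 𝕜 H₀] [CompleteSpace H₀]
    (A : Ω → H →L[𝕜] H₀) (hA : IsOperatorValuedParsevalFrame μ A)
    (B : Δ → H →L[𝕜] H₀) (hB : IsOperatorValuedParsevalFrame ν B) :
    ∀ h ∈ entropyDomain A ∩ entropyDomain B,
      ENNReal.log (μ Set.univ * ν Set.univ) ≥
          continuousShannonEntropy μ A h + continuousShannonEntropy ν B h ∧
        continuousShannonEntropy μ A h + continuousShannonEntropy ν B h ≥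
          -2 * ENNReal.log (⨆ (α : Ω) (β : Δ), ‖B β ∘L ContinuousLinearMap.adjoint (A α)‖ₑ) := by
  rintro h ⟨⟨hh, hAh⟩, -, hBh⟩
  constructor
  · rw [ENNReal.log_mul_add]
    exact add_le_add (hA.continuousShannonEntropy_le_log hh)
      (hB.continuousShannonEntropy_le_log hh)
  set s : ENNReal := ⨆ (α : Ω) (β : Δ), ‖B β ∘L ContinuousLinearMap.adjoint (A α)‖ₑ with hs
  by_cases hs' : s = ⊤
  · have : (-2 : EReal) * ⊤ = ⊥ := EReal.coe_mul_top_of_neg (x := -2) (by norm_num)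
    rw [hs', ENNReal.log_top, this]
    exact bot_le
  have hM (α : Ω) (β : Δ) : ‖B β ∘L ContinuousLinearMap.adjoint (A α)‖ ≤ s.toReal := by
    rw [← toReal_enorm]
    exact ENNReal.toReal_mono hs' (le_iSup₂_of_le α β le_rfl)
  let _ := InnerProductSpace.rclikeToReal 𝕜 H
  have hp := hA.isWeakResolution hAh
  have hq := hB.isWeakResolution hBh
  have hpq (α : Ω) (β : Δ) : |inner ℝ (ContinuousLinearMap.adjoint (A α) (A α h))
      (ContinuousLinearMap.adjoint (B β) (B β h))| ≤ s.toReal * ‖A α h‖ * ‖B β h‖ := by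
    rw [real_inner_eq_re_inner 𝕜]
    exact IsOperatorValuedParsevalFrame.abs_re_inner_adjoint_le _ _ _ _ (hM α β)
  have hqp (β : Δ) (α : Ω) : |inner ℝ (ContinuousLinearMap.adjoint (B β) (B β h))
      (ContinuousLinearMap.adjoint (A α) (A α h))| ≤ s.toReal * ‖B β h‖ * ‖A α h‖ := by
    rw [real_inner_comm, mul_right_comm]
    exact hpq α β
  -- With `s ≠ ⊤`, positivity makes `ENNReal.log s` a real logarithm.
  have hs0 := hp.bound_pos hq hh hpq
  have hmain := hp.integral_sq_mul_log_add_le_log hq hh hs0 hpq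
  have hlog : -2 * ENNReal.log s = ((-2 * Real.log s.toReal : ℝ) : EReal) := by
    rw [ENNReal.log_pos_real' hs0, EReal.coe_mul]
    rfl
  rw [hA.continuousShannonEntropy_eq hAh (hp.le_mul_integral hq hpq),
    hB.continuousShannonEntropy_eq hBh (hq.le_mul_integral hp hqp), hlog, ← EReal.coe_add,
    ge_iff_le, EReal.coe_le_coe_iff]
  linarith
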